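/- Let $F_n$ denote the $n$-th Fibonacci number ($F_0=0$, $F_1=1$, $F_{n+2}=F_{n+1}+F_n$) and, for real $x$, let $A(x)=\#\{n\in\mathbb{N} : 1\le n\le x,\ n\mid F_n\}$. Then there is a function $\varepsilon:\mathbb{R}\to\mathbb{R}$ with $\varepsilon(x)\to 0$ as $x\to\infty$ such that for all sufficiently large $x$ $$\log A(x)\le \log x-\left(\tfrac12+\varepsilon(x)\right)\frac{\log x\,\log\log\log x}{\log\log x},$$ or, equivalently, $$A(x)\le x^{\,1-\left(\frac12+\varepsilon(x)\right)\frac{\log\log\log x}{\log\log x}}.$$ -/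

import Mathlib

open Real Filter Topology

/-- The set of self-Fibonacci divisors: positive integers `n` dividing the `n`-th Fibonacci
number. -/
def selfFibDivisors : Set ℕ := {n : ℕ | 0 < n ∧ n ∣ Nat.fib n}

/-- The counting function `A(x) = #{n ≤ x : n ∣ F_n}` for real `x`. -/
noncomputable def selfFibCount (x : ℝ) : ℕ :=
  Set.ncard {n : ℕ | n ∈ selfFibDivisors ∧ (n : ℝ) ≤ x}

/-- A prime `q ≠ 5` divides one of the two Fibonacci numbers adjacent to index `q`. -/
theorem prime_dvd_fib_pred_or_succ {q : ℕ} (hq : q.Prime) (h5 : q ≠ 5) :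
    q ∣ Nat.fib (q - 1) ∨ q ∣ Nat.fib (q + 1) := by
  have := Fact.mk hq
  let K := AlgebraicClosure (ZMod q)
  have : CharP K q := inferInstance
  obtain ⟨a, ha⟩ : ∃ a : K, a * a = a + 1 := by
    obtain ⟨a, ha⟩ := IsAlgClosed.exists_root (Polynomial.X ^ 2 - Polynomial.X - 1 : Polynomial K)
      (by
        have : (Polynomial.X ^ 2 - Polynomial.X - 1 : Polynomial K).degree = 2 := by
          compute_degree!
        rw [this]; norm_num)
    refine ⟨a, ?_⟩
    simp [Polynomial.IsRoot] at ha
    linear_combination ha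
  have hfib : ∀ n : ℕ, (Nat.fib n : K) * (2 * a - 1) = a ^ n - (1 - a) ^ n := by
    intro n
    induction n using Nat.twoStepInduction with
    | zero => simp
    | one => simp; ring
    | more n h1 h2 =>
      rw [Nat.fib_add_two]
      push_cast
      rw [add_mul, h1, h2]
      linear_combination (-a ^ n + (1 - a) ^ n) * ha
  have hdisc : 2 * a - 1 ≠ 0 := by
    intro h
    have h5' : ((5 : ℕ) : K) = 0 := by
      push_cast
      linear_combination (2 * a - 1) * h - 4 * ha
    rw [CharP.cast_eq_zero_iff K q] at h5'
    exact h5 ((Nat.prime_dvd_prime_iff_eq hq (by norm_num)).1 h5')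
  have ha0 : a ≠ 0 := by
    rintro rfl
    simp at ha
  have hb0 : 1 - a ≠ 0 := by
    intro h
    have h1 : a = 1 := by linear_combination -h
    rw [h1] at ha
    exact one_ne_zero (α := K) (by linear_combination -ha)
  have hfrob : (a ^ q) * (a ^ q) = a ^ q + 1 := by
    have := congrArg (fun t => t ^ q) ha
    simpa [mul_pow, add_pow_char] using this
  have hb : (1 - a) ^ q = 1 - a ^ q := by
    rw [sub_pow_char]; simp
  have hcases : (a ^ q - a) * (a ^ q - (1 - a)) = 0 := by
    linear_combination hfrob - ha
  have hdvd : ∀ n, a ^ n = (1 - a) ^ n → q ∣ Nat.fib n := by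
    intro n h
    rw [← CharP.cast_eq_zero_iff K q]
    have := hfib n
    rw [h, sub_self] at this
    exact (mul_eq_zero.1 this).resolve_right hdisc
  rcases mul_eq_zero.1 hcases with h | h
  · left
    apply hdvd
    have e1 : a ^ q = a := by linear_combination h
    have e2 : (1 - a) ^ q = 1 - a := by rw [hb, e1]
    rw [← pow_sub_one_mul hq.ne_zero] at e1 e2
    rw [mul_eq_right₀ ha0 |>.1 e1, mul_eq_right₀ hb0 |>.1 e2]
  · right
    apply hdvd
    have e1 : a ^ q = 1 - a := by linear_combination h
    rw [pow_succ, pow_succ, hb, e1]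
    ring

theorem fib_mul_modEq (M k : ℕ) :
    (Nat.fib M : ℤ) ^ 2 ∣ Nat.fib ((k + 1) * M) - (k + 1) * Nat.fib M * Nat.fib (M + 1) ^ k ∧
    (Nat.fib M : ℤ) ^ 2 ∣ Nat.fib ((k + 1) * M + 1) - Nat.fib (M + 1) ^ (k + 1) := by
  rcases M with _ | M
  · simp
  induction k with
  | zero => simp
  | succ k ih =>
    obtain ⟨⟨u, hu⟩, ⟨v, hv⟩⟩ := ih
    have e1 : Nat.fib ((k + 1 + 1) * (M + 1)) =
        Nat.fib ((k + 1) * (M + 1)) * Nat.fib M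
          + Nat.fib ((k + 1) * (M + 1) + 1) * Nat.fib (M + 1) := by
      rw [← Nat.fib_add]; congr 1; ring
    have e2 : Nat.fib ((k + 1 + 1) * (M + 1) + 1) =
        Nat.fib ((k + 1) * (M + 1)) * Nat.fib (M + 1)
          + Nat.fib ((k + 1) * (M + 1) + 1) * Nat.fib (M + 1 + 1) := by
      rw [← Nat.fib_add]; congr 1; ring
    have e3 : (Nat.fib (M + 1 + 1) : ℤ) = Nat.fib M + Nat.fib (M + 1) := by
      exact_mod_cast Nat.fib_add_two
    have hM : (Nat.fib M : ℤ) = Nat.fib (M + 1 + 1) - Nat.fib (M + 1) := by linarith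
    rw [e1, e2]
    push_cast
    rw [hM]
    generalize (Nat.fib (M + 1 + 1) : ℤ) = B at *
    generalize (Nat.fib (M + 1) : ℤ) = A at *
    have hu' : (Nat.fib ((k + 1) * (M + 1)) : ℤ) = A ^ 2 * u + (k + 1) * A * B ^ k := by
      linear_combination hu
    have hv' : (Nat.fib ((k + 1) * (M + 1) + 1) : ℤ) = A ^ 2 * v + B ^ (k + 1) := by
      linear_combination hv
    rw [hu', hv']
    constructor
    · exact ⟨u * (B - A) - (k + 1) * B ^ k + v * A, by ring⟩
    · exact ⟨u * A + (k + 1) * B ^ k + v * B, by ring⟩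

theorem pow_succ_dvd_fib_mul {q b M : ℕ} (hq : q ≠ 0) (h : q ^ (b + 1) ∣ Nat.fib M) :
    q ^ (b + 2) ∣ Nat.fib (q * M) := by
  obtain ⟨k, rfl⟩ := Nat.exists_eq_succ_of_ne_zero hq
  have h1 := (fib_mul_modEq M k).1
  zify at h ⊢
  have h2 : ((k + 1 : ℤ)) ^ (b + 2) ∣ (Nat.fib M : ℤ) ^ 2 := by
    refine dvd_trans ?_ (pow_dvd_pow_of_dvd h 2)
    rw [← pow_mul]
    exact pow_dvd_pow _ (by omega)
  have h3 : ((k + 1 : ℤ)) ^ (b + 2) ∣ (k + 1) * Nat.fib M * Nat.fib (M + 1) ^ k := by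
    apply Dvd.dvd.mul_right
    rw [pow_succ, mul_comm]
    exact mul_dvd_mul_left _ h
  have := dvd_add (h2.trans h1) h3
  simpa using this

/-- The rank of apparition: the least positive `d` with `n ∣ F_d`. -/
noncomputable def fibRank (n : ℕ) : ℕ := sInf {d : ℕ | 0 < d ∧ n ∣ Nat.fib d}

theorem exists_prime_dvd_fib {q : ℕ} (hq : q.Prime) : ∃ d, 0 < d ∧ q ∣ Nat.fib d := by
  by_cases h5 : q = 5
  · exact ⟨5, by norm_num, by subst h5; decide⟩
  · rcases prime_dvd_fib_pred_or_succ hq h5 with h | h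
    · exact ⟨q - 1, by have := hq.two_le; omega, h⟩
    · exact ⟨q + 1, by omega, h⟩

theorem exists_dvd_fib {n : ℕ} (hn : n ≠ 0) : ∃ d, 0 < d ∧ n ∣ Nat.fib d := by
  induction n using Nat.recOnPosPrimePosCoprime with
  | zero => exact absurd rfl hn
  | one => exact ⟨1, by norm_num, one_dvd _⟩
  | prime_pow p b hp hb =>
    obtain ⟨c, rfl⟩ := Nat.exists_eq_succ_of_ne_zero hb.ne'
    clear hb hn
    induction c with
    | zero => simpa using exists_prime_dvd_fib hp
    | succ c ih =>
      obtain ⟨d, hd, h⟩ := ih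
      exact ⟨p * d, Nat.mul_pos hp.pos hd, pow_succ_dvd_fib_mul hp.ne_zero h⟩
  | coprime a b ha hb hab iha ihb =>
    obtain ⟨d, hd, h⟩ := iha (by omega)
    obtain ⟨e, he, h'⟩ := ihb (by omega)
    exact ⟨d * e, Nat.mul_pos hd he, hab.mul_dvd_of_dvd_of_dvd
      (h.trans (Nat.fib_dvd _ _ (dvd_mul_right _ _)))
      (h'.trans (Nat.fib_dvd _ _ (dvd_mul_left _ _)))⟩

theorem fibRank_spec {n : ℕ} (hn : n ≠ 0) : 0 < fibRank n ∧ n ∣ Nat.fib (fibRank n) :=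
  Nat.sInf_mem (s := {d : ℕ | 0 < d ∧ n ∣ Nat.fib d}) (exists_dvd_fib hn)

theorem dvd_fib_iff {n m : ℕ} (hn : n ≠ 0) : n ∣ Nat.fib m ↔ fibRank n ∣ m := by
  have hs := fibRank_spec hn
  constructor
  · intro h
    have hg : n ∣ Nat.fib (Nat.gcd (fibRank n) m) := by
      rw [Nat.fib_gcd]; exact Nat.dvd_gcd hs.2 h
    have hle : fibRank n ≤ Nat.gcd (fibRank n) m :=
      Nat.sInf_le ⟨Nat.gcd_pos_of_pos_left _ hs.1, hg⟩
    have := Nat.dvd_antisymm (Nat.gcd_dvd_left (fibRank n) m)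
      (by rw [Nat.le_antisymm hle (Nat.gcd_le_left _ hs.1)]; simp)
    rw [← this]; exact Nat.gcd_dvd_right _ _
  · intro h
    exact hs.2.trans (Nat.fib_dvd _ _ h)

theorem fibRank_dvd_fibRank {m n : ℕ} (hn : n ≠ 0) (h : m ∣ n) : fibRank m ∣ fibRank n := by
  have hm : m ≠ 0 := by rintro rfl; exact hn (zero_dvd_iff.1 h)
  exact (dvd_fib_iff hm).1 (h.trans (fibRank_spec hn).2)

theorem fibRank_prime_dvd {q : ℕ} (hq : q.Prime) (h5 : q ≠ 5) :
    fibRank q ∣ q - 1 ∨ fibRank q ∣ q + 1 := by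
  rw [← dvd_fib_iff hq.ne_zero, ← dvd_fib_iff hq.ne_zero]
  exact prime_dvd_fib_pred_or_succ hq h5

theorem fibRank_prime_pow_dvd {q : ℕ} (hq : q.Prime) (b : ℕ) :
    fibRank (q ^ (b + 1)) ∣ q ^ b * fibRank q := by
  rw [← dvd_fib_iff (pow_ne_zero _ hq.ne_zero)]
  induction b with
  | zero => simpa using (fibRank_spec hq.ne_zero).2
  | succ b ih =>
    rw [pow_succ' q b, mul_assoc]
    exact pow_succ_dvd_fib_mul hq.ne_zero ih

theorem Nat.Prime.pow_dvd_lcm {p a m n : ℕ} (hp : p.Prime) (hm : m ≠ 0) (hn : n ≠ 0)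
    (h : p ^ a ∣ Nat.lcm m n) : p ^ a ∣ m ∨ p ^ a ∣ n := by
  rw [hp.pow_dvd_iff_le_factorization (Nat.lcm_ne_zero hm hn), Nat.factorization_lcm hm hn] at h
  rw [hp.pow_dvd_iff_le_factorization hm, hp.pow_dvd_iff_le_factorization hn]
  simpa using h

theorem exists_prime_pow_of_pow_dvd_fibRank {p a n : ℕ} (hp : p.Prime) (ha : a ≠ 0) (hn : n ≠ 0)
    (h : p ^ a ∣ fibRank n) :
    ∃ q b, q.Prime ∧ q ^ (b + 1) ∣ n ∧ p ^ a ∣ fibRank (q ^ (b + 1)) := by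
  induction n using Nat.recOnPosPrimePosCoprime with
  | zero => exact absurd rfl hn
  | one =>
    have h1 : fibRank 1 ∣ 1 := (dvd_fib_iff one_ne_zero).1 (one_dvd _)
    have := Nat.dvd_one.1 (h.trans h1)
    rw [Nat.pow_eq_one] at this
    exact absurd this (by simp [ha, hp.one_lt.ne'])
  | prime_pow q b hq hb =>
    obtain ⟨c, rfl⟩ := Nat.exists_eq_succ_of_ne_zero hb.ne'
    exact ⟨q, c, hq, dvd_rfl, h⟩
  | coprime m k hm hk hmk ihm ihk =>
    have hm0 : m ≠ 0 := by omega
    have hk0 : k ≠ 0 := by omega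
    have hl : fibRank (m * k) ∣ Nat.lcm (fibRank m) (fibRank k) := by
      rw [← dvd_fib_iff hn]
      exact hmk.mul_dvd_of_dvd_of_dvd ((dvd_fib_iff hm0).2 (Nat.dvd_lcm_left _ _))
        ((dvd_fib_iff hk0).2 (Nat.dvd_lcm_right _ _))
    rcases hp.pow_dvd_lcm (fibRank_spec hm0).1.ne' (fibRank_spec hk0).1.ne' (h.trans hl) with h | h
    · obtain ⟨q, b, hq, hd, h⟩ := ihm hm0 h
      exact ⟨q, b, hq, hd.mul_right _, h⟩
    · obtain ⟨q, b, hq, hd, h⟩ := ihk hk0 h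
      exact ⟨q, b, hq, hd.mul_left _, h⟩

theorem exists_larger_prime_of_pow_dvd_fibRank {p n : ℕ} (hp : p.Prime) (h5 : 5 < p) (hn : n ≠ 0)
    (hpn : p ∣ n) (h : p ^ n.factorization p ∣ fibRank n) :
    ∃ q, q.Prime ∧ q ∣ n ∧ p < q ∧ p ^ n.factorization p ∣ fibRank q := by
  have ha : n.factorization p ≠ 0 := (hp.factorization_pos_of_dvd hn hpn).ne'
  obtain ⟨q, b, hq, hqn, hd⟩ := exists_prime_pow_of_pow_dvd_fibRank hp ha hn h
  have hd' := hd.trans (fibRank_prime_pow_dvd hq b)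
  have hpp : ∀ r : ℕ, r.Prime → r ≠ 5 → p ∣ fibRank r → p ∣ r - 1 ∨ p ∣ r + 1 := by
    intro r hr hr5 hdr
    rcases fibRank_prime_dvd hr hr5 with h | h
    · exact Or.inl (hdr.trans h)
    · exact Or.inr (hdr.trans h)
  by_cases hqp : q = p
  · exfalso
    subst hqp
    have hcop : Nat.Coprime q (fibRank q) := by
      rw [hq.coprime_iff_not_dvd]
      intro hdr
      have h2 := hq.two_le
      rcases hpp q hq (by omega) hdr with h | h
      · have := Nat.le_of_dvd (by omega) h; omega
      · have := (Nat.dvd_add_right (dvd_refl q)).1 h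
        exact hq.one_lt.ne' (Nat.dvd_one.1 this)
    have h1 := (Nat.Coprime.pow_left (n.factorization q) hcop).dvd_of_dvd_mul_right hd'
    rw [Nat.pow_dvd_pow_iff_le_right hq.one_lt] at h1
    have h2 := (hq.pow_dvd_iff_le_factorization hn).1 hqn
    omega
  · have hcop : Nat.Coprime (p ^ n.factorization p) (q ^ b) :=
      Nat.Coprime.pow _ _ ((Nat.coprime_primes hp hq).2 (Ne.symm hqp))
    have h1 := hcop.dvd_of_dvd_mul_left hd'
    have hpq : p ∣ fibRank q := (dvd_pow_self p ha).trans h1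
    refine ⟨q, hq, (dvd_pow_self q (by omega)).trans hqn, ?_, h1⟩
    by_cases hq5 : q = 5
    · exfalso
      subst hq5
      have : fibRank 5 ∣ 5 := (dvd_fib_iff (by norm_num)).1 (by decide)
      have := Nat.le_of_dvd (by norm_num) (hpq.trans this)
      omega
    · have h2 := hq.two_le
      rcases hpp q hq hq5 hpq with h | h
      · have := Nat.le_of_dvd (by omega) h; omega
      · have h3 := Nat.le_of_dvd (by omega) h
        rcases Nat.lt_or_ge p q with h4 | h4
        · exact h4
        exfalso
        have h4 : p = q + 1 := by omega
        rcases hp.eq_two_or_odd with h5 | h5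
        · omega
        rcases hq.eq_two_or_odd with h6 | h6 <;> omega

/-- All positive `n` with `n = k * fibRank n` have the same part coprime to `30 k`. -/
theorem factorization_eq_of_fibRank {k n n' p : ℕ} (hn : n ≠ 0) (hn' : n' ≠ 0)
    (h : k * fibRank n = n) (h' : k * fibRank n' = n') (hp : p.Prime) (hpk : ¬ p ∣ 30 * k) :
    n.factorization p = n'.factorization p := by
  have key : ∀ N : ℕ, ∀ n n' p : ℕ, n ≠ 0 → n' ≠ 0 → k * fibRank n = n → k * fibRank n' = n' →
      p.Prime → ¬ p ∣ 30 * k → n + n' ≤ N + p → n.factorization p ≤ n'.factorization p := by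
    intro N
    induction N with
    | zero =>
      intro n n' p hn hn' h h' hp hpk hN
      rw [Nat.factorization_eq_zero_of_lt (by omega)]
      exact Nat.zero_le _
    | succ N ih =>
      intro n n' p hn hn' h h' hp hpk hN
      by_cases hpn : p ∣ n
      swap
      · rw [Nat.factorization_eq_zero_of_not_dvd hpn]; exact Nat.zero_le _
      have h5 : 5 < p := by
        by_contra hlt
        apply hpk
        apply Dvd.dvd.mul_right
        have : p ≤ 5 := by omega
        interval_cases p <;> first | decide | exact absurd hp (by decide)
      have hcop : Nat.Coprime p k := by
        rw [hp.coprime_iff_not_dvd]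
        exact fun hd => hpk (hd.mul_left _)
      have hdvd : p ^ n.factorization p ∣ fibRank n := by
        refine (Nat.Coprime.pow_left _ hcop).dvd_of_dvd_mul_left ?_
        rw [h]; exact Nat.ordProj_dvd n p
      obtain ⟨q, hq, hqn, hpq, hd⟩ := exists_larger_prime_of_pow_dvd_fibRank hp h5 hn hpn hdvd
      have hqn' : q ∣ n' := by
        by_cases hqk : q ∣ 30 * k
        · rcases (hq.dvd_mul).1 hqk with h1 | h1
          · exfalso
            rw [show 30 = 2 * 3 * 5 by norm_num] at h1
            rcases (hq.dvd_mul).1 h1 with h1 | h1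
            · rcases (hq.dvd_mul).1 h1 with h1 | h1
              · have := Nat.le_of_dvd (by norm_num) h1; omega
              · have := Nat.le_of_dvd (by norm_num) h1; omega
            · have := Nat.le_of_dvd (by norm_num) h1; omega
          · rw [← h']; exact h1.mul_right _
        · have := ih n n' q hn hn' h h' hq hqk (by omega)
          have h1 := hq.factorization_pos_of_dvd hn hqn
          exact Nat.dvd_of_factorization_pos (by omega)
      have h1 : p ^ n.factorization p ∣ n' := by
        rw [← h']
        exact (hd.trans (fibRank_dvd_fibRank hn' hqn')).mul_left _
      exact (hp.pow_dvd_iff_le_factorization hn').1 h1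
  exact le_antisymm (key (n + n') n n' p hn hn' h h' hp hpk (by omega))
    (key (n + n') n' n p hn' hn h' h hp hpk (by omega))

/-- The part of `n` supported on the primes in `s`. -/
def smoothPart (s : Finset ℕ) (n : ℕ) : ℕ := ∏ p ∈ s, p ^ n.factorization p

theorem smoothPart_ne_zero {s : Finset ℕ} (hs : ∀ p ∈ s, p.Prime) (n : ℕ) :
    smoothPart s n ≠ 0 :=
  Finset.prod_ne_zero_iff.2 fun p hp => pow_ne_zero _ (hs p hp).ne_zero

theorem factorization_smoothPart {s : Finset ℕ} (hs : ∀ p ∈ s, p.Prime) (n : ℕ) (q : ℕ) :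
    (smoothPart s n).factorization q = if q ∈ s then n.factorization q else 0 := by
  rw [smoothPart, Nat.factorization_prod fun p hp => pow_ne_zero _ (hs p hp).ne_zero]
  rw [Finsupp.finsetSum_apply,
    Finset.sum_congr rfl fun p hp => by rw [(hs p hp).factorization_pow, Finsupp.single_apply]]
  simp [Finset.sum_ite_eq']

theorem smoothPart_le {s : Finset ℕ} (hs : ∀ p ∈ s, p.Prime) {n : ℕ} (hn : n ≠ 0) :
    smoothPart s n ≤ n := by
  apply Nat.le_of_dvd (Nat.pos_of_ne_zero hn)
  rw [← Nat.factorization_le_iff_dvd (smoothPart_ne_zero hs n) hn]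
  intro q
  rw [factorization_smoothPart hs]
  split_ifs <;> simp

theorem smoothPart_mem_factoredNumbers {s : Finset ℕ} (hs : ∀ p ∈ s, p.Prime) (n : ℕ) :
    smoothPart s n ∈ Nat.factoredNumbers s := by
  apply Nat.mem_factoredNumbers_of_primeFactors_subset (smoothPart_ne_zero hs n)
  intro q hq
  by_contra hqs
  have h := factorization_smoothPart hs n q
  rw [if_neg hqs] at h
  have := (Nat.prime_of_mem_primeFactors hq).factorization_pos_of_dvd (smoothPart_ne_zero hs n)
    (Nat.dvd_of_mem_primeFactors hq)
  omega

theorem smoothPart_injOn (k : ℕ) (hk : k ≠ 0) :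
    Set.InjOn (smoothPart (30 * k).primeFactors) {n | n ≠ 0 ∧ k * fibRank n = n} := by
  intro n hn n' hn' h
  have hs : ∀ p ∈ (30 * k).primeFactors, p.Prime := fun p hp => Nat.prime_of_mem_primeFactors hp
  apply Nat.eq_of_factorization_eq hn.1 hn'.1
  intro q
  by_cases hq : q.Prime
  swap
  · simp [Nat.factorization_eq_zero_of_not_prime _ hq]
  by_cases hqk : q ∣ 30 * k
  · have h1 := congrArg (fun m => m.factorization q) h
    simp only [factorization_smoothPart hs] at h1
    have hmem : q ∈ (30 * k).primeFactors :=
      Nat.mem_primeFactors.2 ⟨hq, hqk, by omega⟩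
    rwa [if_pos hmem, if_pos hmem] at h1
  · exact factorization_eq_of_fibRank hn.1 hn'.1 hn.2 hn'.2 hq hqk

/-- The completely multiplicative function `n ↦ n ^ (-s)`. -/
noncomputable def rpowNegHom (s : ℝ) : ℕ →* ℝ where
  toFun n := (n : ℝ) ^ (-s)
  map_one' := by simp
  map_mul' m n := by
    push_cast
    exact Real.mul_rpow (Nat.cast_nonneg _) (Nat.cast_nonneg _)

theorem rpowNegHom_apply (s : ℝ) (n : ℕ) : rpowNegHom s n = (n : ℝ) ^ (-s) := rfl

theorem prime_rpow_neg_lt_one {p : ℕ} (hp : p.Prime) {s : ℝ} (hs : 0 < s) :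
    (p : ℝ) ^ (-s) < 1 :=
  Real.rpow_lt_one_of_one_lt_of_neg (by exact_mod_cast hp.one_lt) (by linarith)

theorem one_le_euler_factor {p : ℕ} (hp : p.Prime) {s : ℝ} (hs : 0 < s) :
    1 ≤ (1 - (p : ℝ) ^ (-s))⁻¹ := by
  have h1 := prime_rpow_neg_lt_one hp hs
  have h2 : (0 : ℝ) ≤ (p : ℝ) ^ (-s) := by positivity
  exact (one_le_inv₀ (by linarith)).2 (by linarith)

theorem sum_rpow_neg_le_prod {P T : Finset ℕ} (hP : ∀ p ∈ P, p.Prime) {s : ℝ} (hs : 0 < s)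
    (hT : ∀ m ∈ T, m ∈ Nat.factoredNumbers P) :
    ∑ m ∈ T, (m : ℝ) ^ (-s) ≤ ∏ p ∈ P, (1 - (p : ℝ) ^ (-s))⁻¹ := by
  have h := (EulerProduct.summable_and_hasSum_factoredNumbers_prod_filter_prime_geometric
    (f := rpowNegHom s) (fun {p} hp => by
      rw [rpowNegHom_apply, Real.norm_of_nonneg (by positivity)]
      exact prime_rpow_neg_lt_one hp hs) P).2
  rw [Finset.filter_true_of_mem hP] at h
  let g : {m // m ∈ T} ↪ Nat.factoredNumbers P :=
    ⟨fun m => ⟨m.1, hT m.1 m.2⟩, fun a b hab => by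
      
      exact Subtype.ext (congrArg (fun t : Nat.factoredNumbers P => (t : ℕ)) hab)⟩
  have h2 := sum_le_hasSum (T.attach.map g) (fun i _ => by
    rw [rpowNegHom_apply]; positivity) h
  rw [Finset.sum_map] at h2
  rw [← Finset.sum_attach]
  exact h2

theorem card_le_rpow_mul_prod {P T : Finset ℕ} (hP : ∀ p ∈ P, p.Prime) {s y : ℝ} (hs : 0 < s)
    (hy0 : 0 ≤ y)
    (hT : ∀ m ∈ T, m ∈ Nat.factoredNumbers P) (hy : ∀ m ∈ T, (m : ℝ) ≤ y) :
    (T.card : ℝ) ≤ y ^ s * ∏ p ∈ P, (1 - (p : ℝ) ^ (-s))⁻¹ := by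
  have h1 : (T.card : ℝ) ≤ ∑ m ∈ T, y ^ s * (m : ℝ) ^ (-s) := by
    rw [Finset.card_eq_sum_ones, Nat.cast_sum]
    refine Finset.sum_le_sum fun m hm => ?_
    have hm0 : (0 : ℝ) < m := by
      exact_mod_cast Nat.pos_of_ne_zero (Nat.ne_zero_of_mem_factoredNumbers (hT m hm))
    rw [Real.rpow_neg hm0.le, ← div_eq_mul_inv, Nat.cast_one, one_le_div (by positivity)]
    exact Real.rpow_le_rpow hm0.le (hy m hm) hs.le
  rw [← Finset.mul_sum] at h1
  exact h1.trans (mul_le_mul_of_nonneg_left (sum_rpow_neg_le_prod hP hs hT) (by positivity))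

theorem prod_euler_factor_le_exp {P : Finset ℕ} (hP : ∀ p ∈ P, p.Prime) {s : ℝ} (hs : 1 / 2 ≤ s) :
    ∏ p ∈ P, (1 - (p : ℝ) ^ (-s))⁻¹ ≤ Real.exp (4 * ∑ p ∈ P, (p : ℝ) ^ (-s)) := by
  rw [Finset.mul_sum, Real.exp_sum]
  refine Finset.prod_le_prod (fun p hp => zero_le_one.trans
    (one_le_euler_factor (hP p hp) (by linarith))) fun p hp => ?_
  have hp2 : (2 : ℝ) ≤ p := by exact_mod_cast (hP p hp).two_le
  have h1 : (p : ℝ) ^ (-s) ≤ 3 / 4 := by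
    have h2 : (p : ℝ) ^ (-s) ≤ (p : ℝ) ^ (-(1 / 2) : ℝ) :=
      Real.rpow_le_rpow_of_exponent_le (by linarith) (by linarith)
    have h3 : (p : ℝ) ^ (-(1 / 2) : ℝ) = (√p)⁻¹ := by
      rw [Real.rpow_neg (by linarith), Real.sqrt_eq_rpow]
    have h4 : (4 / 3 : ℝ) ≤ √p := Real.le_sqrt_of_sq_le (by norm_num; linarith)
    have h5 : (√p)⁻¹ ≤ (4 / 3 : ℝ)⁻¹ := inv_anti₀ (by norm_num) h4
    norm_num at h5
    linarith
  have h0 : 0 ≤ (p : ℝ) ^ (-s) := by positivity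
  generalize (p : ℝ) ^ (-s) = t at *
  have h2 : (1 - t)⁻¹ ≤ 1 + 4 * t := by
    rw [inv_le_iff_one_le_mul₀ (by linarith)]
    nlinarith
  linarith [Real.add_one_le_exp (4 * t)]

theorem sum_Icc_rpow_le {η : ℝ} (h0 : 0 < η) (h1 : η ≤ 1) (J : ℕ) :
    ∑ j ∈ Finset.Icc 1 J, (j : ℝ) ^ (η - 1) ≤ (J : ℝ) ^ η / η := by
  induction J with
  | zero => simp [Real.zero_rpow h0.ne']
  | succ J ih =>
    rw [Finset.sum_Icc_succ_top (by omega)]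
    have hJ : (0 : ℝ) < ((J + 1 : ℕ) : ℝ) := by positivity
    have hinv : ((J + 1 : ℕ) : ℝ)⁻¹ ≤ 1 :=
      inv_le_one_of_one_le₀ (by push_cast; linarith [Nat.cast_nonneg (α := ℝ) J])
    have hb := rpow_one_add_le_one_add_mul_self
      (s := -((J + 1 : ℕ) : ℝ)⁻¹) (by
        linarith) h0.le h1
    have hJ' : (J : ℝ) = ((J + 1 : ℕ) : ℝ) * (1 + -((J + 1 : ℕ) : ℝ)⁻¹) := by
      field_simp; push_cast; ring
    have hnn : 0 ≤ 1 + -((J + 1 : ℕ) : ℝ)⁻¹ := by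
      linarith
    have h2 : (J : ℝ) ^ η ≤ ((J + 1 : ℕ) : ℝ) ^ η * (1 + η * -((J + 1 : ℕ) : ℝ)⁻¹) := by
      rw [hJ', Real.mul_rpow hJ.le hnn]
      exact mul_le_mul_of_nonneg_left hb (by positivity)
    have h3 : ((J + 1 : ℕ) : ℝ) ^ (η - 1) = ((J + 1 : ℕ) : ℝ) ^ η * ((J + 1 : ℕ) : ℝ)⁻¹ := by
      rw [Real.rpow_sub hJ, Real.rpow_one, div_eq_mul_inv]
    rw [h3]
    rw [le_div_iff₀ h0] at ih ⊢
    nlinarith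

theorem pow_card_le_of_primeFactors {N : ℕ} (hN : N ≠ 0) {T : Finset ℕ} (hT : T ⊆ N.primeFactors)
    {y : ℝ} (hy0 : 0 ≤ y) (hy : ∀ p ∈ T, y ≤ p) : y ^ T.card ≤ N := by
  have h1 : ∏ p ∈ T, p ∣ N :=
    (Finset.prod_dvd_prod_of_subset _ _ _ hT).trans (Nat.prod_primeFactors_dvd N)
  have h2 : ((∏ p ∈ T, p : ℕ) : ℝ) ≤ N := by
    exact_mod_cast Nat.le_of_dvd (Nat.pos_of_ne_zero hN) h1
  rw [← Finset.prod_const]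
  refine le_trans ?_ h2
  push_cast
  exact Finset.prod_le_prod (fun _ _ => hy0) hy

/-- A set of prime divisors of `N`, all at least `y`, has at most `log N / log y` elements. -/
theorem card_mul_log_le_of_primeFactors {N : ℕ} (hN : N ≠ 0) {T : Finset ℕ}
    (hT : T ⊆ N.primeFactors) {y : ℝ} (hy0 : 0 < y) (hy : ∀ p ∈ T, y ≤ p) :
    T.card * Real.log y ≤ Real.log N := by
  rw [← Real.log_pow]
  exact Real.log_le_log (by positivity) (pow_card_le_of_primeFactors hN hT hy0.le hy)

theorem fib_le_two_pow (n : ℕ) : Nat.fib n ≤ 2 ^ n := by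
  induction n using Nat.twoStepInduction with
  | zero => simp
  | one => simp
  | more n h1 h2 => rw [Nat.fib_add_two, pow_succ, pow_succ] at *; omega

/-- If the elements `p` of `T` have distinct indices `1 ≤ j p ≤ e` with `j p * e ≤ 2 p`, as for
elements of a residue class modulo `e`, the sum over `T` compares with the sum over indices. -/
theorem sum_rpow_neg_le_of_index {η : ℝ} (h0 : 0 < η) (h1 : η ≤ 1) {e : ℕ} (he : e ≠ 0)
    {T : Finset ℕ} (j : ℕ → ℕ) (hj : Set.InjOn j T) (hj1 : ∀ p ∈ T, j p ∈ Finset.Icc 1 e)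
    (hle : ∀ p ∈ T, (j p * e : ℝ) ≤ 2 * p) :
    ∑ p ∈ T, (p : ℝ) ^ (η - 1) ≤ 2 / η * (e : ℝ) ^ (2 * η - 1) := by
  have he0 : (0 : ℝ) < e := by exact_mod_cast Nat.pos_of_ne_zero he
  have hterm : ∀ p ∈ T, (p : ℝ) ^ (η - 1) ≤ 2 * (e : ℝ) ^ (η - 1) * (j p : ℝ) ^ (η - 1) := by
    intro p hp
    have hjp : (0 : ℝ) < j p := by exact_mod_cast (Finset.mem_Icc.1 (hj1 p hp)).1
    have h2 : (p : ℝ) ^ (η - 1) ≤ (j p * e / 2 : ℝ) ^ (η - 1) :=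
      Real.rpow_le_rpow_of_nonpos (by positivity) (by linarith [hle p hp]) (by linarith)
    refine h2.trans ?_
    rw [Real.div_rpow (by positivity) (by norm_num), Real.mul_rpow hjp.le he0.le,
      div_eq_mul_inv, ← Real.rpow_neg (by norm_num)]
    have h3 : (2 : ℝ) ^ (-(η - 1)) ≤ 2 := by
      calc (2 : ℝ) ^ (-(η - 1)) ≤ 2 ^ (1 : ℝ) :=
            Real.rpow_le_rpow_of_exponent_le (by norm_num) (by linarith)
        _ = 2 := by simp
    calc _ ≤ (j p : ℝ) ^ (η - 1) * (e : ℝ) ^ (η - 1) * 2 :=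
          mul_le_mul_of_nonneg_left h3 (by positivity)
      _ = _ := by ring
  have h2 : ∑ p ∈ T, (j p : ℝ) ^ (η - 1) ≤ (e : ℝ) ^ η / η := by
    refine le_trans ?_ (sum_Icc_rpow_le h0 h1 e)
    rw [← Finset.sum_image (f := fun i : ℕ => (i : ℝ) ^ (η - 1)) hj]
    exact Finset.sum_le_sum_of_subset_of_nonneg
      (Finset.image_subset_iff.2 hj1) fun _ _ _ => by positivity
  refine (Finset.sum_le_sum hterm).trans ?_
  rw [← Finset.mul_sum]
  refine (mul_le_mul_of_nonneg_left h2 (by positivity)).trans (le_of_eq ?_)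
  rw [show 2 * η - 1 = (η - 1) + η by ring, Real.rpow_add he0]
  ring

/-- A bound for the sum of `p ^ (η - 1)` over primes with a fixed rank of apparition `e`. -/
theorem sum_rpow_neg_le_of_fibRank_eq {η : ℝ} (h0 : 0 < η) (h1 : η ≤ 1) {e : ℕ} (he : e ≠ 0)
    {T : Finset ℕ} (hT : ∀ p ∈ T, p.Prime ∧ p ≠ 5 ∧ fibRank p = e) :
    ∑ p ∈ T, (p : ℝ) ^ (η - 1) ≤ 5 / η * (e : ℝ) ^ (2 * η - 1) := by
  rcases T.eq_empty_or_nonempty with rfl | ⟨p₀, hp₀⟩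
  · simp only [Finset.sum_empty]; positivity
  have he2 : 2 ≤ e := by
    by_contra hlt
    have he1 : e = 1 := by omega
    obtain ⟨hp, -, h⟩ := hT p₀ hp₀
    have := (fibRank_spec hp.ne_zero).2
    rw [h, he1, Nat.fib_one] at this
    exact hp.one_lt.ne' (Nat.dvd_one.1 this)
  have he0 : (0 : ℝ) < e := by exact_mod_cast Nat.pos_of_ne_zero he
  set A := T.filter (fun p => ¬ p ≤ e ^ 2) with hA
  set B := T.filter (fun p => p ≤ e ^ 2) with hB
  set B₁ := B.filter (fun p => e ∣ p - 1) with hB₁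
  set B₂ := B.filter (fun p => ¬ e ∣ p - 1) with hB₂
  have hsplit : ∑ p ∈ T, (p : ℝ) ^ (η - 1) =
      (∑ p ∈ B₁, (p : ℝ) ^ (η - 1) + ∑ p ∈ B₂, (p : ℝ) ^ (η - 1))
        + ∑ p ∈ A, (p : ℝ) ^ (η - 1) := by
    rw [Finset.sum_filter_add_sum_filter_not, Finset.sum_filter_add_sum_filter_not]
  have hsA : ∑ p ∈ A, (p : ℝ) ^ (η - 1) ≤ (e : ℝ) ^ (2 * η - 1) := by
    have hsub : A ⊆ (Nat.fib e).primeFactors := by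
      intro p hp
      obtain ⟨hp, -, h⟩ := hT p (Finset.mem_filter.1 hp).1
      rw [Nat.mem_primeFactors]
      refine ⟨hp, ?_, (Nat.fib_pos.2 (by omega)).ne'⟩
      rw [← h]; exact (fibRank_spec hp.ne_zero).2
    have hcard : A.card ≤ e := by
      have h2 := pow_card_le_of_primeFactors (Nat.fib_pos.2 (by omega : 0 < e)).ne' hsub
        (y := 2) (by norm_num) (fun p hp => by
          exact_mod_cast (Nat.prime_of_mem_primeFactors (hsub hp)).two_le)
      have h3 : 2 ^ A.card ≤ 2 ^ e := by
        refine le_trans ?_ (fib_le_two_pow e)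
        exact_mod_cast h2
      exact (Nat.pow_le_pow_iff_right (by norm_num)).1 h3
    have hterm : ∀ p ∈ A, (p : ℝ) ^ (η - 1) ≤ (e : ℝ) ^ (2 * (η - 1)) := by
      intro p hp
      rw [Real.rpow_mul he0.le]
      refine Real.rpow_le_rpow_of_nonpos (by positivity) ?_ (by linarith)
      have := (Finset.mem_filter.1 hp).2
      push Not at this
      rw [Real.rpow_two]
      exact_mod_cast this.le
    calc _ ≤ A.card • (e : ℝ) ^ (2 * (η - 1)) := Finset.sum_le_card_nsmul _ _ _ hterm
      _ ≤ (e : ℝ) * (e : ℝ) ^ (2 * (η - 1)) := by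
        rw [nsmul_eq_mul]
        exact mul_le_mul_of_nonneg_right (by exact_mod_cast hcard) (by positivity)
      _ = (e : ℝ) ^ (2 * η - 1) := by
        rw [show 2 * η - 1 = 1 + 2 * (η - 1) by ring, Real.rpow_add he0, Real.rpow_one]
  have hs1 : ∑ p ∈ B₁, (p : ℝ) ^ (η - 1) ≤ 2 / η * (e : ℝ) ^ (2 * η - 1) := by
    have hp : ∀ p ∈ B₁, 2 ≤ p ∧ p ≤ e ^ 2 ∧ (p - 1) / e * e = p - 1 := by
      intro p hp
      simp only [hB₁, hB, Finset.mem_filter] at hp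
      exact ⟨(hT p hp.1.1).1.two_le, hp.1.2, Nat.div_mul_cancel hp.2⟩
    refine sum_rpow_neg_le_of_index h0 h1 he (fun p => (p - 1) / e) ?_ ?_ ?_
    · intro p hp1 q hq1 h
      have a := hp p hp1
      have b := hp q hq1
      simp only at h
      rw [h, b.2.2] at a
      omega
    · intro p hp1
      have a := hp p hp1
      rw [Finset.mem_Icc]
      constructor
      · rcases Nat.eq_zero_or_pos ((p - 1) / e) with h | h
        · rw [h] at a; omega
        · exact h
      · apply Nat.div_le_of_le_mul
        rw [← pow_two]; omega
    · intro p hp1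
      have a := hp p hp1
      have : (p - 1) / e * e ≤ 2 * p := by omega
      exact_mod_cast this
  have hs2 : ∑ p ∈ B₂, (p : ℝ) ^ (η - 1) ≤ 2 / η * (e : ℝ) ^ (2 * η - 1) := by
    have hp : ∀ p ∈ B₂, 2 ≤ p ∧ p ≤ e ^ 2 ∧ (p + 1) / e * e = p + 1 := by
      intro p hp
      simp only [hB₂, hB, Finset.mem_filter] at hp
      obtain ⟨hpp, hp5, hpe⟩ := hT p hp.1.1
      have := fibRank_prime_dvd hpp hp5
      rw [hpe] at this
      exact ⟨hpp.two_le, hp.1.2, Nat.div_mul_cancel (this.resolve_left hp.2)⟩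
    refine sum_rpow_neg_le_of_index h0 h1 he (fun p => (p + 1) / e) ?_ ?_ ?_
    · intro p hp1 q hq1 h
      have a := hp p hp1
      have b := hp q hq1
      simp only at h
      rw [h, b.2.2] at a
      omega
    · intro p hp1
      have a := hp p hp1
      rw [Finset.mem_Icc]
      constructor
      · rcases Nat.eq_zero_or_pos ((p + 1) / e) with h | h
        · rw [h] at a; omega
        · exact h
      · rw [← Nat.lt_succ_iff, Nat.div_lt_iff_lt_mul (by omega)]
        have : (e + 1) * e = e ^ 2 + e := by ring
        rw [Nat.succ_eq_add_one, this]; omega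
    · intro p hp1
      have a := hp p hp1
      have : (p + 1) / e * e ≤ 2 * p := by omega
      exact_mod_cast this
  rw [hsplit]
  have h4 : (e : ℝ) ^ (2 * η - 1) ≤ 1 / η * (e : ℝ) ^ (2 * η - 1) := by
    apply le_mul_of_one_le_left (by positivity)
    rw [le_div_iff₀ h0]; linarith
  calc _ ≤ (2 / η * (e : ℝ) ^ (2 * η - 1) + 2 / η * (e : ℝ) ^ (2 * η - 1))
        + 1 / η * (e : ℝ) ^ (2 * η - 1) := by gcongr; exact hsA.trans h4
    _ = _ := by ring

theorem sum_primeFactors_fib_le {η : ℝ} (h0 : 0 < η) (h1 : η ≤ 1) {d : ℕ} (hd : d ≠ 0) :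
    ∑ p ∈ (Nat.fib d).primeFactors, (p : ℝ) ^ (η - 1) ≤
      1 + 5 / η * ∑ e ∈ d.divisors, (e : ℝ) ^ (2 * η - 1) := by
  set P := (Nat.fib d).primeFactors
  have h2 : ∑ p ∈ P, (p : ℝ) ^ (η - 1) =
      ∑ p ∈ P with p = 5, (p : ℝ) ^ (η - 1) + ∑ p ∈ P with p ≠ 5, (p : ℝ) ^ (η - 1) :=
    (Finset.sum_filter_add_sum_filter_not _ _ _).symm
  have h3 : ∑ p ∈ P with p = 5, (p : ℝ) ^ (η - 1) ≤ 1 := by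
    have : P.filter (fun p => p = 5) ⊆ {5} := by
      intro p hp; simpa using (Finset.mem_filter.1 hp).2
    refine (Finset.sum_le_sum_of_subset_of_nonneg this fun _ _ _ => by positivity).trans ?_
    simp only [Finset.sum_singleton]
    exact Real.rpow_le_one_of_one_le_of_nonpos (by norm_num) (by linarith)
  have hmaps : ∀ p ∈ P.filter (fun p => p ≠ 5), fibRank p ∈ d.divisors := by
    intro p hp
    have := Nat.mem_primeFactors.1 (Finset.mem_filter.1 hp).1
    exact Nat.mem_divisors.2 ⟨(dvd_fib_iff this.1.ne_zero).1 this.2.1, hd⟩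
  rw [h2, ← Finset.sum_fiberwise_of_maps_to hmaps, Finset.mul_sum]
  refine add_le_add h3 (Finset.sum_le_sum fun e he => ?_)
  refine sum_rpow_neg_le_of_fibRank_eq h0 h1 (Nat.pos_of_mem_divisors he).ne' fun p hp => ?_
  simp only [Finset.mem_filter] at hp
  exact ⟨Nat.prime_of_mem_primeFactors hp.1.1, hp.1.2, hp.2⟩

theorem sum_divisors_rpow_le {η : ℝ} (h1 : η ≤ 1 / 4) {d : ℕ} (hd : d ≠ 0) :
    ∑ e ∈ d.divisors, (e : ℝ) ^ (2 * η - 1) ≤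
      Real.exp (4 * ∑ p ∈ d.primeFactors, (p : ℝ) ^ (2 * η - 1)) := by
  have hP : ∀ p ∈ d.primeFactors, p.Prime := fun p hp => Nat.prime_of_mem_primeFactors hp
  have h := (sum_rpow_neg_le_prod (T := d.divisors) hP (s := 1 - 2 * η) (by linarith)
    fun m hm => Nat.mem_factoredNumbers_of_primeFactors_subset (Nat.pos_of_mem_divisors hm).ne'
      (Nat.primeFactors_mono (Nat.dvd_of_mem_divisors hm) hd)).trans
    (prod_euler_factor_le_exp hP (by linarith))
  simpa only [neg_sub] using h

theorem sum_inv_primes_dyadic (i : ℕ) (hi : i ≠ 0) :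
    ∑ p ∈ Finset.Ico (2 ^ i : ℕ) (2 ^ (i + 1)) with Nat.Prime p, (p : ℝ)⁻¹ ≤ 4 / i := by
  set T := (Finset.Ico (2 ^ i) (2 ^ (i + 1))).filter Nat.Prime with hT
  have hi0 : (0 : ℝ) < i := by exact_mod_cast Nat.pos_of_ne_zero hi
  have hsub : T ⊆ (primorial (2 ^ (i + 1))).primeFactors := by
    intro p hp
    simp only [hT, Finset.mem_filter, Finset.mem_Ico] at hp
    rw [Nat.mem_primeFactors]
    refine ⟨hp.2, ?_, (primorial_pos _).ne'⟩
    rw [hp.2.dvd_primorial_iff]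
    exact hp.1.2.le
  have h1 := pow_card_le_of_primeFactors (primorial_pos _).ne' hsub (y := 2 ^ i) (by positivity)
    (fun p hp => by
      simp only [hT, Finset.mem_filter, Finset.mem_Ico] at hp
      exact_mod_cast hp.1.1)
  have h2 : (2 : ℕ) ^ (i * T.card) ≤ 2 ^ (2 * 2 ^ (i + 1)) := by
    rw [pow_mul, pow_mul 2 2]
    exact (by exact_mod_cast h1 : (2 ^ i) ^ T.card ≤ primorial (2 ^ (i + 1))).trans
      (primorial_le_four_pow _)
  have h3 : i * T.card ≤ 4 * 2 ^ i := by
    have := (Nat.pow_le_pow_iff_right (by norm_num)).1 h2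
    rw [pow_succ] at this; omega
  have h3' : (i : ℝ) * T.card ≤ 4 * 2 ^ i := by exact_mod_cast h3
  calc ∑ p ∈ T, (p : ℝ)⁻¹ ≤ T.card • ((2 : ℝ) ^ i)⁻¹ := by
        refine Finset.sum_le_card_nsmul _ _ _ fun p hp => ?_
        simp only [hT, Finset.mem_filter, Finset.mem_Ico] at hp
        exact inv_anti₀ (by positivity) (by exact_mod_cast hp.1.1)
    _ ≤ 4 / i := by
        rw [nsmul_eq_mul, ← div_eq_mul_inv, div_le_div_iff₀ (by positivity) hi0]
        linarith

theorem sum_inv_primes_lt_two_pow (I : ℕ) :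
    ∑ p ∈ Finset.range (2 ^ (I + 1)) with p.Prime, (p : ℝ)⁻¹ ≤ 4 * (1 + Real.log I) := by
  have h : ∑ p ∈ Finset.range (2 ^ (I + 1)) with p.Prime, (p : ℝ)⁻¹ ≤ 4 * (harmonic I : ℝ) := by
    induction I with
    | zero =>
      have : (Finset.range (2 ^ (0 + 1))).filter Nat.Prime = ∅ := by decide
      rw [this]; simp
    | succ I ih =>
      have hd := sum_inv_primes_dyadic (I + 1) (by omega)
      rw [Finset.sum_filter, ← Finset.sum_range_add_sum_Ico _
        (Nat.pow_le_pow_right (by norm_num) (by omega : I + 1 ≤ I + 1 + 1)),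
        ← Finset.sum_filter, ← Finset.sum_filter, harmonic_succ]
      push_cast at hd ⊢
      rw [div_eq_mul_inv] at hd
      linarith
  exact h.trans (mul_le_mul_of_nonneg_left (harmonic_le_one_add_log I) (by norm_num))

theorem sum_inv_primes_le {Y : ℝ} (hY : 2 ≤ Y) :
    ∑ p ∈ Finset.range (⌊Y⌋₊ + 1) with p.Prime, (p : ℝ)⁻¹ ≤ 4 * (1 + Real.log (2 * Real.log Y)) := by
  set I := Nat.log 2 ⌊Y⌋₊ with hI
  have hf : 2 ≤ ⌊Y⌋₊ := Nat.le_floor (by exact_mod_cast hY)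
  have h1 : ⌊Y⌋₊ < 2 ^ (I + 1) := Nat.lt_pow_succ_log_self (by norm_num) _
  have hI1 : 1 ≤ I := Nat.log_pos (by norm_num) hf
  have h2 : (2 : ℝ) ^ I ≤ Y := by
    have : 2 ^ I ≤ ⌊Y⌋₊ := Nat.pow_log_le_self 2 (by omega)
    calc (2 : ℝ) ^ I ≤ (⌊Y⌋₊ : ℝ) := by exact_mod_cast this
      _ ≤ Y := Nat.floor_le (by linarith)
  have h3 : (I : ℝ) ≤ 2 * Real.log Y := by
    have := Real.log_le_log (by positivity) h2
    rw [Real.log_pow] at this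
    have hl := Real.log_two_gt_d9
    have : (0 : ℝ) ≤ I := Nat.cast_nonneg _
    nlinarith
  refine le_trans (Finset.sum_le_sum_of_subset_of_nonneg ?_ fun _ _ _ => by positivity)
    ((sum_inv_primes_lt_two_pow I).trans ?_)
  · apply Finset.filter_subset_filter
    exact Finset.range_subset_range.2 (by omega)
  · have : (0 : ℝ) < I := by exact_mod_cast hI1
    gcongr

theorem sum_primeFactors_rpow_le {η Y : ℝ} (h0 : 0 ≤ η) (h1 : η ≤ 1 / 4) (hY : 2 ≤ Y) {d : ℕ}
    (hd : d ≠ 0) (hdY : Real.log d ≤ Y) :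
    ∑ p ∈ d.primeFactors, (p : ℝ) ^ (2 * η - 1) ≤
      Y ^ (2 * η) * (4 * (1 + Real.log (2 * Real.log Y)) + 1 / Real.log Y) := by
  have hY0 : 0 < Y := by linarith
  have hlog : 0 < Real.log Y := Real.log_pos (by linarith)
  rw [← Finset.sum_filter_add_sum_filter_not d.primeFactors (fun p : ℕ => (p : ℝ) ≤ Y), mul_add]
  refine add_le_add ?_ ?_
  · refine le_trans ?_ (mul_le_mul_of_nonneg_left (sum_inv_primes_le hY) (by positivity))
    rw [Finset.mul_sum]
    have hsub : d.primeFactors.filter (fun p : ℕ => (p : ℝ) ≤ Y) ⊆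
        (Finset.range (⌊Y⌋₊ + 1)).filter Nat.Prime := by
      intro p hp
      rw [Finset.mem_filter] at hp
      rw [Finset.mem_filter, Finset.mem_range, Nat.lt_succ_iff]
      exact ⟨Nat.le_floor hp.2, Nat.prime_of_mem_primeFactors hp.1⟩
    refine le_trans (Finset.sum_le_sum fun p hp => ?_)
      (Finset.sum_le_sum_of_subset_of_nonneg hsub fun _ _ _ => by positivity)
    rw [Finset.mem_filter] at hp
    have hp0 : (0 : ℝ) < p := by exact_mod_cast (Nat.prime_of_mem_primeFactors hp.1).pos
    rw [Real.rpow_sub hp0, Real.rpow_one, div_eq_mul_inv]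
    gcongr
    exact hp.2
  · set T := d.primeFactors.filter (fun p : ℕ => ¬ (p : ℝ) ≤ Y) with hT
    have hgt : ∀ p ∈ T, Y ≤ p := fun p hp => (not_le.1 (Finset.mem_filter.1 hp).2).le
    have hc := card_mul_log_le_of_primeFactors hd (Finset.filter_subset _ _) hY0 hgt
    have hc' : (T.card : ℝ) ≤ Y / Real.log Y := by
      rw [le_div_iff₀ hlog]; linarith
    calc ∑ p ∈ T, (p : ℝ) ^ (2 * η - 1) ≤ T.card • Y ^ (2 * η - 1) :=
          Finset.sum_le_card_nsmul _ _ _ fun p hp =>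
            Real.rpow_le_rpow_of_nonpos hY0 (hgt p hp) (by linarith)
      _ ≤ Y / Real.log Y * Y ^ (2 * η - 1) := by
          rw [nsmul_eq_mul]
          exact mul_le_mul_of_nonneg_right hc' (by positivity)
      _ = _ := by
          rw [Real.rpow_sub hY0, Real.rpow_one]; field_simp

/-- A bound for the Euler product over the primes dividing `N`, split at `Z`. -/
theorem prod_euler_factor_le {N : ℕ} (hN : N ≠ 0) {s Z : ℝ} (h0 : 0 < s) (h1 : s ≤ 1) (hZ : 1 < Z)
    (hsZ : Z ^ (-s) ≤ 1 / 2) :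
    ∏ p ∈ N.primeFactors, (1 - (p : ℝ) ^ (-s))⁻¹ ≤
      (2 / s) ^ Z * 2 ^ (Real.log N / Real.log Z) := by
  have hlog : 0 < Real.log Z := Real.log_pos hZ
  have hs2 : 1 ≤ 2 / s := by rw [le_div_iff₀ h0]; linarith
  rw [← Finset.prod_filter_mul_prod_filter_not N.primeFactors (fun p : ℕ => (p : ℝ) ≤ Z)]
  refine mul_le_mul ?_ ?_ ?_ (by positivity)
  · set T := N.primeFactors.filter (fun p : ℕ => (p : ℝ) ≤ Z) with hT
    have hcard : (T.card : ℝ) ≤ Z := by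
      have hsub : T ⊆ Finset.Icc 1 ⌊Z⌋₊ := by
        intro p hp
        rw [Finset.mem_filter] at hp
        exact Finset.mem_Icc.2 ⟨(Nat.prime_of_mem_primeFactors hp.1).one_le, Nat.le_floor hp.2⟩
      have := Finset.card_le_card hsub
      rw [Nat.card_Icc, Nat.add_sub_cancel] at this
      exact (by exact_mod_cast this : (T.card : ℝ) ≤ ⌊Z⌋₊).trans (Nat.floor_le (by linarith))
    have h2 : ∏ p ∈ T, (1 - (p : ℝ) ^ (-s))⁻¹ ≤ ∏ p ∈ T, (2 / s) := by
      refine Finset.prod_le_prod (fun p hp => zero_le_one.trans (one_le_euler_factor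
        (Nat.prime_of_mem_primeFactors (Finset.mem_filter.1 hp).1) h0)) fun p hp => ?_
      have hp2 : (2 : ℝ) ≤ p := by
        exact_mod_cast (Nat.prime_of_mem_primeFactors (Finset.mem_filter.1 hp).1).two_le
      have h3 : (p : ℝ) ^ (-s) ≤ 2 ^ (-s) :=
        Real.rpow_le_rpow_of_nonpos (by norm_num) hp2 (by linarith)
      have h4 : (2 : ℝ) ^ (-s) ≤ 1 - s / 2 := by
        have := rpow_one_add_le_one_add_mul_self (s := -(1 / 2)) (by norm_num) h0.le h1
        rw [show (1 + -(1 / 2) : ℝ) = 2⁻¹ by norm_num, Real.inv_rpow (by norm_num),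
          ← Real.rpow_neg (by norm_num)] at this
        linarith
      rw [← inv_div]
      exact inv_anti₀ (by positivity) (by linarith)
    rw [Finset.prod_const, ← Real.rpow_natCast] at h2
    exact h2.trans (Real.rpow_le_rpow_of_exponent_le hs2 hcard)
  · set T := N.primeFactors.filter (fun p : ℕ => ¬ (p : ℝ) ≤ Z) with hT
    have hgt : ∀ p ∈ T, Z ≤ p := fun p hp => (not_le.1 (Finset.mem_filter.1 hp).2).le
    have hc := card_mul_log_le_of_primeFactors hN (Finset.filter_subset _ _) (by linarith) hgt
    have h2 : ∏ p ∈ T, (1 - (p : ℝ) ^ (-s))⁻¹ ≤ ∏ p ∈ T, (2 : ℝ) := by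
      refine Finset.prod_le_prod (fun p hp => zero_le_one.trans (one_le_euler_factor
        (Nat.prime_of_mem_primeFactors (Finset.mem_filter.1 hp).1) h0)) fun p hp => ?_
      have h3 : (p : ℝ) ^ (-s) ≤ Z ^ (-s) :=
        Real.rpow_le_rpow_of_nonpos (by linarith) (hgt p hp) (by linarith)
      rw [show (2 : ℝ) = (1 / 2)⁻¹ by norm_num]
      exact inv_anti₀ (by norm_num) (by linarith)
    rw [Finset.prod_const, ← Real.rpow_natCast] at h2
    refine h2.trans (Real.rpow_le_rpow_of_exponent_le (by norm_num) ?_)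
    rw [le_div_iff₀ hlog]
    exact hc
  · exact Finset.prod_nonneg fun p hp => zero_le_one.trans (one_le_euler_factor
        (Nat.prime_of_mem_primeFactors (Finset.mem_filter.1 hp).1) h0)

/-- The self-Fibonacci divisors up to `x`, as a finite set. -/
noncomputable def selfFibFinset (x : ℝ) : Finset ℕ :=
  (Finset.Icc 1 ⌊x⌋₊).filter fun n => fibRank n ∣ n

theorem mem_selfFibFinset {x : ℝ} (hx : 0 ≤ x) {n : ℕ} :
    n ∈ selfFibFinset x ↔ n ≠ 0 ∧ (n : ℝ) ≤ x ∧ fibRank n ∣ n := by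
  rw [selfFibFinset, Finset.mem_filter, Finset.mem_Icc, Nat.le_floor_iff hx,
    Nat.one_le_iff_ne_zero, and_assoc]

theorem selfFibCount_eq_card {x : ℝ} (hx : 0 ≤ x) :
    selfFibCount x = (selfFibFinset x).card := by
  rw [selfFibCount, ← Set.ncard_coe_finset]
  congr 1
  ext n
  rw [Finset.mem_coe, mem_selfFibFinset hx, Set.mem_ofPred_eq, selfFibDivisors, Set.mem_ofPred_eq]
  constructor
  · rintro ⟨⟨h1, h2⟩, h3⟩
    exact ⟨h1.ne', h3, (dvd_fib_iff h1.ne').1 h2⟩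
  · rintro ⟨h1, h2, h3⟩
    exact ⟨⟨Nat.pos_of_ne_zero h1, (dvd_fib_iff h1).2 h3⟩, h2⟩

theorem card_filter_fibRank_gt_le {x s D Z : ℝ} (hx : 1 ≤ x) (h0 : 0 < s) (h1 : s ≤ 1)
    (hZ : 1 < Z) (hsZ : Z ^ (-s) ≤ 1 / 2) (hD : 1 ≤ D) :
    (((selfFibFinset x).filter fun n => ¬ (fibRank n : ℝ) ≤ D).card : ℝ) ≤
      x / D * (x ^ s * ((2 / s) ^ Z * 2 ^ (Real.log (30 * x) / Real.log Z))) := by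
  set S := (selfFibFinset x).filter fun n => ¬ (fibRank n : ℝ) ≤ D with hS
  have hx0 : 0 ≤ x := by linarith
  have hlogZ : 0 < Real.log Z := Real.log_pos hZ
  have hmem : ∀ n ∈ S, n ≠ 0 ∧ (n : ℝ) ≤ x ∧ fibRank n ∣ n ∧ D < fibRank n := by
    intro n hn
    rw [hS, Finset.mem_filter, mem_selfFibFinset hx0, not_le] at hn
    exact ⟨hn.1.1, hn.1.2.1, hn.1.2.2, hn.2⟩
  have hmaps : ∀ n ∈ S, n / fibRank n ∈ Finset.Icc 1 ⌊x / D⌋₊ := by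
    intro n hn
    obtain ⟨hn0, hnx, hdvd, hDn⟩ := hmem n hn
    have hr := (fibRank_spec hn0).1
    rw [Finset.mem_Icc]
    refine ⟨Nat.div_pos (Nat.le_of_dvd (Nat.pos_of_ne_zero hn0) hdvd) hr, Nat.le_floor ?_⟩
    rw [Nat.cast_div hdvd (by exact_mod_cast hr.ne')]
    gcongr
  rw [Finset.card_eq_sum_card_fiberwise hmaps, Nat.cast_sum]
  have hfib : ∀ k ∈ Finset.Icc 1 ⌊x / D⌋₊,
      (((S.filter fun n => n / fibRank n = k).card : ℕ) : ℝ) ≤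
        x ^ s * ((2 / s) ^ Z * 2 ^ (Real.log (30 * x) / Real.log Z)) := by
    intro k hk
    rw [Finset.mem_Icc] at hk
    have hk0 : k ≠ 0 := by omega
    have hk0' : (0 : ℝ) < k := by exact_mod_cast Nat.pos_of_ne_zero hk0
    have hkx : (k : ℝ) ≤ x :=
      ((Nat.le_floor_iff (by positivity)).1 hk.2).trans (div_le_self hx0 hD)
    have hP : ∀ p ∈ (30 * k).primeFactors, p.Prime := fun p hp => Nat.prime_of_mem_primeFactors hp
    have hinj : Set.InjOn (smoothPart (30 * k).primeFactors)
        (S.filter fun n => n / fibRank n = k : Finset ℕ) := by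
      refine (smoothPart_injOn k hk0).mono fun n hn => ?_
      rw [Finset.mem_coe, Finset.mem_filter] at hn
      obtain ⟨hn0, -, hdvd, -⟩ := hmem n hn.1
      exact ⟨hn0, by rw [← hn.2, Nat.div_mul_cancel hdvd]⟩
    rw [← Finset.card_image_of_injOn hinj]
    refine (card_le_rpow_mul_prod hP h0 hx0 ?_ ?_).trans ?_
    · intro m hm
      obtain ⟨n, -, rfl⟩ := Finset.mem_image.1 hm
      exact smoothPart_mem_factoredNumbers hP n
    · intro m hm
      obtain ⟨n, hn, rfl⟩ := Finset.mem_image.1 hm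
      obtain ⟨hn0, hnx, -⟩ := hmem n (Finset.mem_filter.1 hn).1
      exact le_trans (by exact_mod_cast smoothPart_le hP hn0) hnx
    · refine mul_le_mul_of_nonneg_left ((prod_euler_factor_le (by omega) h0 h1 hZ hsZ).trans ?_)
        (by positivity)
      have : Real.log ((30 * k : ℕ) : ℝ) ≤ Real.log (30 * x) := by
        apply Real.log_le_log
        · push_cast; positivity
        · push_cast; linarith
      gcongr
      norm_num
  refine (Finset.sum_le_card_nsmul _ _ _ hfib).trans ?_
  rw [nsmul_eq_mul, Nat.card_Icc, Nat.add_sub_cancel]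
  exact mul_le_mul_of_nonneg_right (Nat.floor_le (by positivity)) (by positivity)

theorem card_filter_fibRank_le_le {x η D B : ℝ} (hx : 1 ≤ x) (h0 : 0 < η) (h1 : η ≤ 1 / 4)
    (hD : 1 ≤ D)
    (hB : ∀ d : ℕ, d ≠ 0 → (d : ℝ) ≤ D →
      ∏ p ∈ (Nat.fib d).primeFactors, (1 - (p : ℝ) ^ (-(1 - η)))⁻¹ ≤ B) :
    (((selfFibFinset x).filter fun n => (fibRank n : ℝ) ≤ D).card : ℝ) ≤
      x ^ (1 - η) * B * (D ^ η / η) := by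
  set S := (selfFibFinset x).filter fun n => (fibRank n : ℝ) ≤ D with hS
  have hx0 : 0 ≤ x := by linarith
  have hmem : ∀ n ∈ S, n ≠ 0 ∧ (n : ℝ) ≤ x ∧ fibRank n ∣ n ∧ (fibRank n : ℝ) ≤ D := by
    intro n hn
    rw [hS, Finset.mem_filter, mem_selfFibFinset hx0] at hn
    exact ⟨hn.1.1, hn.1.2.1, hn.1.2.2, hn.2⟩
  have hmaps : ∀ n ∈ S, fibRank n ∈ Finset.Icc 1 ⌊D⌋₊ := by
    intro n hn
    obtain ⟨hn0, hnx, hdvd, hDn⟩ := hmem n hn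
    exact Finset.mem_Icc.2 ⟨(fibRank_spec hn0).1, Nat.le_floor hDn⟩
  rw [Finset.card_eq_sum_card_fiberwise hmaps, Nat.cast_sum]
  have hB0 : 0 ≤ B := by
    have h := hB 1 one_ne_zero (by simpa using hD)
    simp only [Nat.fib_one, Nat.primeFactors_one, Finset.prod_empty] at h
    linarith
  have hfib : ∀ d ∈ Finset.Icc 1 ⌊D⌋₊, (((S.filter fun n => fibRank n = d).card : ℕ) : ℝ) ≤
      x ^ (1 - η) * B * (d : ℝ) ^ (η - 1) := by
    intro d hd
    rw [Finset.mem_Icc] at hd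
    have hd0 : d ≠ 0 := by omega
    have hd0' : (0 : ℝ) < d := by exact_mod_cast Nat.pos_of_ne_zero hd0
    have hm : ∀ n ∈ S.filter (fun n => fibRank n = d),
        n ≠ 0 ∧ (n : ℝ) ≤ x ∧ d ∣ n ∧ n ∣ Nat.fib d := by
      intro n hn
      rw [Finset.mem_filter] at hn
      obtain ⟨hn0, hnx, hdvd, -⟩ := hmem n hn.1
      rw [hn.2] at hdvd
      refine ⟨hn0, hnx, hdvd, ?_⟩
      rw [dvd_fib_iff hn0, hn.2]
    have hinj : Set.InjOn (fun n => n / d) (S.filter fun n => fibRank n = d : Finset ℕ) := by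
      intro n hn n' hn' h
      exact (Nat.div_left_inj (hm n hn).2.2.1 (hm n' hn').2.2.1).1 h
    rw [← Finset.card_image_of_injOn hinj]
    have hc := card_le_rpow_mul_prod
      (T := (S.filter fun n => fibRank n = d).image fun n => n / d)
      (P := (Nat.fib d).primeFactors) (s := 1 - η) (y := x / d)
      (fun p hp => Nat.prime_of_mem_primeFactors hp) (by linarith) (by positivity) ?_ ?_
    · refine hc.trans ?_
      refine (mul_le_mul_of_nonneg_left (hB d hd0 ((Nat.le_floor_iff (by linarith)).1 hd.2))
        (by positivity)).trans (le_of_eq ?_)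
      rw [Real.div_rpow hx0 hd0'.le, show η - 1 = -(1 - η) by ring, Real.rpow_neg hd0'.le]
      ring
    · intro m hm'
      obtain ⟨n, hn, rfl⟩ := Finset.mem_image.1 hm'
      obtain ⟨hn0, -, hdn, hnd⟩ := hm n hn
      have hf : Nat.fib d ≠ 0 := (Nat.fib_pos.2 (by omega)).ne'
      have hdiv : n / d ∣ Nat.fib d := (Nat.div_dvd_of_dvd hdn).trans hnd
      exact Nat.mem_factoredNumbers_of_primeFactors_subset
        (fun h => hf (zero_dvd_iff.1 (h ▸ hdiv))) (Nat.primeFactors_mono hdiv hf)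
    · intro m hm'
      obtain ⟨n, hn, rfl⟩ := Finset.mem_image.1 hm'
      obtain ⟨hn0, hnx, hdn, -⟩ := hm n hn
      rw [Nat.cast_div hdn hd0'.ne']
      gcongr
  refine (Finset.sum_le_sum hfib).trans ?_
  rw [← Finset.mul_sum]
  refine mul_le_mul_of_nonneg_left ((sum_Icc_rpow_le h0 (by linarith) _).trans ?_) (by positivity)
  gcongr
  exact Nat.floor_le (by linarith)

/-- An explicit bound for the number of self-Fibonacci divisors, depending on parameters. -/
theorem selfFibCount_le {x η s D : ℝ} (hx : 2 ≤ Real.log x) (hx1 : 1 ≤ x) (h0 : 0 < η)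
    (h1 : η ≤ 1 / 4) (hs0 : 0 < s) (hs1 : s ≤ 1) (hD : 1 ≤ D) (hDx : D ≤ x)
    (hsX : √(Real.log x) ^ (-s) ≤ 1 / 2) :
    (selfFibCount x : ℝ) ≤
      x / D * (x ^ s * ((2 / s) ^ √(Real.log x) *
        2 ^ (Real.log (30 * x) / Real.log √(Real.log x)))) +
      x ^ (1 - η) * Real.exp (4 * (1 + 5 / η * Real.exp (4 * (Real.log x ^ (2 * η) *
        (4 * (1 + Real.log (2 * Real.log (Real.log x))) + 1 / Real.log (Real.log x)))))) *
        (D ^ η / η) := by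
  have hZ : 1 < √(Real.log x) := by
    rw [Real.lt_sqrt (by norm_num)]; linarith
  rw [selfFibCount_eq_card (by linarith),
    ← Finset.card_filter_add_card_filter_not (fun n => (fibRank n : ℝ) ≤ D), Nat.cast_add, add_comm]
  refine add_le_add (card_filter_fibRank_gt_le hx1 hs0 hs1 hZ hsX hD)
    (card_filter_fibRank_le_le hx1 h0 h1 hD fun d hd hdD => ?_)
  have hd1 : (0 : ℝ) < d := by exact_mod_cast Nat.pos_of_ne_zero hd
  have hlog : Real.log d ≤ Real.log x := Real.log_le_log hd1 (hdD.trans hDx)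
  have e1 := sum_primeFactors_rpow_le h0.le h1 hx hd hlog
  have e2 := sum_divisors_rpow_le h1 hd
  have e3 := sum_primeFactors_fib_le h0 (by linarith) hd
  have e4 := prod_euler_factor_le_exp (P := (Nat.fib d).primeFactors)
    (fun p hp => Nat.prime_of_mem_primeFactors hp) (s := 1 - η) (by linarith)
  rw [neg_sub] at e4 ⊢
  refine e4.trans ?_
  gcongr
  refine e3.trans ?_
  gcongr
  refine e2.trans ?_
  gcongr

theorem one_le_selfFibCount {x : ℝ} (hx : 1 ≤ x) : 1 ≤ selfFibCount x := by
  rw [selfFibCount_eq_card (by linarith), Nat.one_le_iff_ne_zero, Finset.card_ne_zero]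
  refine ⟨1, (mem_selfFibFinset (by linarith)).2 ⟨one_ne_zero, by simpa using hx, ?_⟩⟩
  exact (dvd_fib_iff one_ne_zero).1 (one_dvd _)

set_option maxHeartbeats 1000000 in
theorem log_selfFibCount_le {x δ u v : ℝ} (hu : Real.log (Real.log x) = u) (hv : Real.log u = v)
    (hx : 1 ≤ x) (hX : 0 < Real.log x) (hδ : 0 < δ) (hδ1 : δ ≤ 1 / 4) (hu1 : 1 ≤ u)
    (hv1 : 4 / δ ≤ v) (hvu : v / u ≤ δ) (hpow : 208 * v ≤ u ^ (2 * δ))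
    (hexp : 84 * u ^ 2 / δ ^ 2 ≤ Real.exp (u / 2)) :
    Real.log (selfFibCount x) ≤
      Real.log x - (1 / 2 - 5 * δ) * (Real.log x * v / u) := by
  have hu0 : 0 < u := by linarith
  have hv16 : 16 ≤ v := by
    refine le_trans ?_ hv1
    rw [le_div_iff₀ hδ]; linarith
  have hXu : Real.log x = Real.exp u := by rw [← hu, Real.exp_log hX]
  have hx0 : 0 < x := by linarith
  have hxX : x = Real.exp (Real.exp u) := by rw [← hXu, Real.exp_log hx0]
  set r := v / u with hr
  have hr0 : 0 < r := by positivity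
  have hru : r * u = v := div_mul_cancel₀ v hu0.ne'
  set W := Real.exp u * r with hW
  have hhalf : Real.exp u = Real.exp (u / 2) * Real.exp (u / 2) := by
    rw [← Real.exp_add]; congr 1; ring
  have hexp84 : 84 * u ^ 2 ≤ δ ^ 2 * Real.exp (u / 2) := by
    rw [div_le_iff₀ (by positivity)] at hexp; linarith
  have he1 : 1 ≤ Real.exp (u / 2) := Real.one_le_exp (by linarith)
  have hδ2 : δ ^ 2 ≤ δ := by nlinarith
  have hW1 : 84 * u * Real.exp (u / 2) ≤ δ ^ 2 * W := by
    have h1 : 84 * u * u * Real.exp (u / 2) ≤ δ ^ 2 * Real.exp u := by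
      rw [hhalf]; nlinarith
    have h2 : δ ^ 2 * Real.exp u * 1 ≤ δ ^ 2 * Real.exp u * (r * u) := by
      rw [hru]
      exact mul_le_mul_of_nonneg_left (by linarith) (by positivity)
    have h3 : 84 * u * Real.exp (u / 2) * u ≤ δ ^ 2 * W * u := by
      calc _ = 84 * u * u * Real.exp (u / 2) := by ring
        _ ≤ δ ^ 2 * Real.exp u * 1 := by linarith
        _ ≤ _ := h2
        _ = _ := by rw [hW]; ring
    exact le_of_mul_le_mul_right h3 hu0
  have hW0 : 0 < W := by positivity
  have hW2 : 84 * u * Real.exp (u / 2) ≤ δ * W :=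
    hW1.trans (mul_le_mul_of_nonneg_right hδ2 hW0.le)
  have hW3 : 84 * u ≤ δ * W := by
    refine le_trans ?_ hW2
    exact le_mul_of_one_le_right (by positivity) he1
  set η := (1 / 2 - δ) * r with hη
  set s := δ * r with hs
  have hη0 : 0 < η := by apply mul_pos <;> linarith
  have hs0 : 0 < s := by positivity
  have hηr : η ≤ r := by nlinarith
  have hη4 : r / 4 ≤ η := by nlinarith
  have hinvη : 1 / η ≤ 4 * u := by
    rw [div_le_iff₀ hη0]
    have := mul_le_mul_of_nonneg_left hη4 (by positivity : 0 ≤ 4 * u)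
    linarith
  have hsX : √(Real.log x) = Real.exp (u / 2) := by
    rw [hXu, Real.sqrt_eq_iff_mul_self_eq (by positivity) (by positivity), ← hhalf]
  have hmain := selfFibCount_le (x := x) (η := η) (s := s) (D := x ^ η)
    (by rw [hXu]; linarith [Real.add_one_le_exp u]) hx hη0 (by linarith) hs0 (by nlinarith)
    (Real.one_le_rpow hx hη0.le)
    (by
      calc x ^ η ≤ x ^ (1 : ℝ) := Real.rpow_le_rpow_of_exponent_le hx (by linarith)
        _ = x := Real.rpow_one x)
    (by
      rw [hsX, ← Real.exp_mul]
      have h1 : u / 2 * -s = -(δ * v / 2) := by rw [hs, ← hru]; ring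
      have h2 : 4 ≤ δ * v := by rw [div_le_iff₀ hδ] at hv1; linarith
      rw [h1, Real.exp_neg, one_div]
      exact inv_anti₀ (by norm_num) (by linarith [Real.add_one_le_exp (δ * v / 2)]))
  have hlogZ : Real.log √(Real.log x) = u / 2 := by rw [hsX, Real.log_exp]
  have hxpow : ∀ t : ℝ, x ^ t = Real.exp (Real.exp u * t) := by
    intro t; rw [Real.rpow_def_of_pos hx0, hXu]
  have ht1 : x / x ^ η * (x ^ s * ((2 / s) ^ √(Real.log x) *
        2 ^ (Real.log (30 * x) / Real.log √(Real.log x)))) ≤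
      Real.exp (Real.exp u - Real.exp u * η + 3 * (δ * W)) := by
    have b1 : (2 / s) ^ √(Real.log x) ≤ Real.exp (δ * W) := by
      rw [hsX, Real.rpow_def_of_pos (by positivity), Real.exp_le_exp]
      have h1 : Real.log (2 / s) ≤ 2 / s := Real.log_le_self (by positivity)
      have h2 : 2 / s ≤ 2 * u / δ := by
        rw [div_le_div_iff₀ hs0 hδ,
          show 2 * u * s = 2 * δ * (r * u) by rw [hs]; ring, hru]
        exact le_mul_of_one_le_right (by positivity) (by linarith) |>.trans' (by linarith)
      calc Real.log (2 / s) * Real.exp (u / 2) ≤ 2 * u / δ * Real.exp (u / 2) :=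
            mul_le_mul_of_nonneg_right (h1.trans h2) (by positivity)
        _ = 2 * u * Real.exp (u / 2) / δ := by ring
        _ ≤ δ * W := by
            rw [div_le_iff₀ hδ]
            have : 0 ≤ u * Real.exp (u / 2) := by positivity
            linarith
    have b2 : (2 : ℝ) ^ (Real.log (30 * x) / Real.log √(Real.log x)) ≤ Real.exp (δ * W) := by
      rw [hlogZ, Real.rpow_def_of_pos (by norm_num), Real.exp_le_exp,
        Real.log_mul (by norm_num) hx0.ne', hXu]
      have h1 : Real.log 2 ≤ 1 := by linarith [Real.log_two_lt_d9]
      have h2 : Real.log 30 ≤ 30 := Real.log_le_self (by norm_num)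
      have h3 : 30 ≤ Real.exp u := by
        have h4 : Real.exp 4 ≤ Real.exp u := Real.exp_le_exp.2 (by linarith [Real.log_le_self hu0.le])
        have h5 : Real.exp 4 = Real.exp 1 ^ 4 := by rw [← Real.exp_nat_mul]; norm_num
        have h6 : (2.7 : ℝ) ^ 4 ≤ Real.exp 1 ^ 4 := by
          gcongr
          linarith [Real.exp_one_gt_d9]
        norm_num at h6
        linarith
      have h5 : (Real.log 30 + Real.exp u) / (u / 2) ≤ 4 * Real.exp u / u := by
        rw [div_le_div_iff₀ (by positivity) hu0]
        have := mul_le_mul_of_nonneg_right (h2.trans h3) hu0.le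
        linarith
      have h6 : 4 * Real.exp u / u ≤ δ * W := by
        have h7 : 4 ≤ δ * v := by rw [div_le_iff₀ hδ] at hv1; linarith
        rw [div_le_iff₀ hu0, show δ * W * u = Real.exp u * (δ * (r * u)) by rw [hW]; ring, hru]
        linarith [mul_le_mul_of_nonneg_left h7 (Real.exp_pos u).le]
      have h8 : 0 ≤ (Real.log 30 + Real.exp u) / (u / 2) := by
        have : 0 ≤ Real.log 30 := Real.log_nonneg (by norm_num)
        positivity
      calc _ ≤ 1 * ((Real.log 30 + Real.exp u) / (u / 2)) :=
            mul_le_mul_of_nonneg_right h1 h8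
        _ ≤ _ := by linarith
    have b3 : x / x ^ η = Real.exp (Real.exp u - Real.exp u * η) := by
      rw [Real.exp_sub, ← hxX, ← hxpow]
    have b4 : x ^ s = Real.exp (δ * W) := by
      rw [hxpow]; congr 1; rw [hs, hW]; ring
    rw [b3, b4]
    calc _ ≤ Real.exp (Real.exp u - Real.exp u * η) *
          (Real.exp (δ * W) * (Real.exp (δ * W) * Real.exp (δ * W))) := by gcongr
      _ = _ := by
        rw [← Real.exp_add, ← Real.exp_add, ← Real.exp_add]; congr 1; ring
  have ht2 : x ^ (1 - η) * Real.exp (4 * (1 + 5 / η * Real.exp (4 * (Real.log x ^ (2 * η) *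
        (4 * (1 + Real.log (2 * Real.log (Real.log x))) + 1 / Real.log (Real.log x)))))) *
        ((x ^ η) ^ η / η) ≤ Real.exp (Real.exp u - Real.exp u * η + 3 * (δ * W)) := by
    have b1 : 4 * (Real.log x ^ (2 * η) *
        (4 * (1 + Real.log (2 * Real.log (Real.log x))) + 1 / Real.log (Real.log x))) ≤ u / 2 := by
      rw [hu]
      have h1 : Real.log x ^ (2 * η) = u ^ (1 - 2 * δ) := by
        rw [Real.rpow_def_of_pos hX, hu, Real.rpow_def_of_pos hu0, hv, ← hru, hη]
        congr 1; ring
      have h2 : Real.log (2 * u) ≤ 1 + v := by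
        rw [Real.log_mul (by norm_num) hu0.ne', hv]
        linarith [Real.log_two_lt_d9]
      have h3 : 1 / u ≤ 1 := by rw [div_le_one hu0]; exact hu1
      have h4 : 8 * (4 * (1 + Real.log (2 * u)) + 1 / u) ≤ u ^ (2 * δ) := by linarith
      have h5 : u ^ (1 - 2 * δ) * u ^ (2 * δ) = u := by
        rw [← Real.rpow_add hu0]; simp
      have h6 := mul_le_mul_of_nonneg_left h4 (by positivity : 0 ≤ u ^ (1 - 2 * δ))
      rw [h1]
      linarith
    have b2 : 4 * (1 + 5 / η * Real.exp (4 * (Real.log x ^ (2 * η) *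
        (4 * (1 + Real.log (2 * Real.log (Real.log x))) + 1 / Real.log (Real.log x))))) ≤
        δ * W := by
      have h1 : 5 / η ≤ 20 * u := by
        have : 5 / η = 5 * (1 / η) := by ring
        linarith
      calc _ ≤ 4 * (1 + 20 * u * Real.exp (u / 2)) := by gcongr
        _ ≤ 84 * u * Real.exp (u / 2) := by
          have : 1 ≤ u * Real.exp (u / 2) := one_le_mul_of_one_le_of_one_le hu1 he1
          linarith
        _ ≤ _ := hW2
    have b3 : (x ^ η) ^ η ≤ Real.exp (δ * W) := by
      rw [← Real.rpow_mul hx0.le, hxpow, Real.exp_le_exp, hW]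
      have h1 : η * η ≤ δ * r := mul_le_mul (hηr.trans hvu) hηr hη0.le hδ.le
      linarith [mul_le_mul_of_nonneg_left h1 (Real.exp_pos u).le]
    have b4 : 1 / η ≤ Real.exp (δ * W) := by
      linarith [Real.add_one_le_exp (δ * W)]
    calc _ = x ^ (1 - η) * Real.exp (4 * (1 + 5 / η * Real.exp (4 * (Real.log x ^ (2 * η) *
        (4 * (1 + Real.log (2 * Real.log (Real.log x))) + 1 / Real.log (Real.log x)))))) *
        ((x ^ η) ^ η * (1 / η)) := by ring
      _ ≤ x ^ (1 - η) * Real.exp (δ * W) * (Real.exp (δ * W) * Real.exp (δ * W)) := by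
        gcongr
      _ = _ := by
        rw [hxpow, ← Real.exp_add, ← Real.exp_add, ← Real.exp_add]; congr 1; ring
  have htotal : (selfFibCount x : ℝ) ≤ Real.exp (Real.exp u - Real.exp u * η + 4 * (δ * W)) := by
    refine (hmain.trans (add_le_add ht1 ht2)).trans ?_
    rw [show Real.exp u - Real.exp u * η + 4 * (δ * W) =
      (Real.exp u - Real.exp u * η + 3 * (δ * W)) + δ * W by ring,
      Real.exp_add (_ + 3 * (δ * W))]
    have : 2 ≤ Real.exp (δ * W) := by linarith [Real.add_one_le_exp (δ * W)]
    linarith [mul_le_mul_of_nonneg_left this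
      (Real.exp_pos (Real.exp u - Real.exp u * η + 3 * (δ * W))).le]
  have hpos : (0 : ℝ) < selfFibCount x := by
    exact_mod_cast one_le_selfFibCount hx
  have hfin := Real.log_le_log hpos htotal
  rw [Real.log_exp] at hfin
  rw [hXu]
  refine hfin.trans (le_of_eq ?_)
  rw [hη, hW, hr]; ring

theorem eventually_log_selfFibCount_le {δ : ℝ} (hδ : 0 < δ) (hδ1 : δ ≤ 1 / 4) :
    ∀ᶠ x : ℝ in atTop, Real.log (selfFibCount x) ≤ Real.log x - (1 / 2 - 5 * δ) *
      (Real.log x * Real.log (Real.log (Real.log x)) / Real.log (Real.log x)) := by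
  have hll : Tendsto (fun x : ℝ => Real.log (Real.log x)) atTop atTop :=
    Real.tendsto_log_atTop.comp Real.tendsto_log_atTop
  have e1 : ∀ᶠ u : ℝ in atTop, 4 / δ ≤ Real.log u :=
    Real.tendsto_log_atTop.eventually_ge_atTop _
  have e2 : ∀ᶠ u : ℝ in atTop, Real.log u / u ≤ δ := by
    have h := (Real.isLittleO_log_id_atTop.tendsto_div_nhds_zero).eventually_le_const hδ
    simpa using h
  have e3 : ∀ᶠ u : ℝ in atTop, 208 * Real.log u ≤ u ^ (2 * δ) := by
    have h := (isLittleO_log_rpow_atTop (r := 2 * δ) (by linarith)).bound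
      (by norm_num : (0 : ℝ) < 1 / 208)
    filter_upwards [h, eventually_ge_atTop 1] with u hu hu1
    rw [Real.norm_of_nonneg (Real.log_nonneg hu1), Real.norm_of_nonneg (by positivity)] at hu
    linarith
  have e4 : ∀ᶠ u : ℝ in atTop, 84 * u ^ 2 / δ ^ 2 ≤ Real.exp (u / 2) := by
    have h := (Real.tendsto_exp_div_pow_atTop 2).comp
      (tendsto_id.atTop_div_const (by norm_num : (0 : ℝ) < 2))
    filter_upwards [h.eventually_ge_atTop (4 * (84 / δ ^ 2)), eventually_gt_atTop 0] with u hu hu0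
    simp only [Function.comp, id] at hu
    rw [le_div_iff₀ (by positivity)] at hu
    calc _ = 4 * (84 / δ ^ 2) * (u / 2) ^ 2 := by ring
      _ ≤ _ := hu
  filter_upwards [hll.eventually e1, hll.eventually e2, hll.eventually e3, hll.eventually e4,
    hll.eventually_ge_atTop 1, eventually_ge_atTop 1,
    Real.tendsto_log_atTop.eventually_gt_atTop 0] with x h1 h2 h3 h4 h5 h6 h7
  exact log_selfFibCount_le rfl rfl h6 h7 hδ hδ1 h5 h1 h2 h3 h4

theorem theorem1 :
    ∃ ε : ℝ → ℝ, Tendsto ε atTop (𝓝 0) ∧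
      ∀ᶠ x : ℝ in atTop,
        Real.log (selfFibCount x : ℝ) ≤
            Real.log x - (1 / 2 + ε x) *
              (Real.log x * Real.log (Real.log (Real.log x)) / Real.log (Real.log x)) ∧
        (selfFibCount x : ℝ) ≤
            x ^ (1 - (1 / 2 + ε x) *
              (Real.log (Real.log (Real.log x)) / Real.log (Real.log x))) := by
  set W : ℝ → ℝ := fun x =>
    Real.log x * Real.log (Real.log (Real.log x)) / Real.log (Real.log x) with hW
  have hll : Tendsto (fun x : ℝ => Real.log (Real.log x)) atTop atTop :=
    Real.tendsto_log_atTop.comp Real.tendsto_log_atTop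
  have hWpos : ∀ᶠ x : ℝ in atTop, 0 < W x := by
    filter_upwards [Real.tendsto_log_atTop.eventually_gt_atTop 0, hll.eventually_gt_atTop 0,
      (Real.tendsto_log_atTop.comp hll).eventually_gt_atTop 0] with x h1 h2 h3
    exact div_pos (mul_pos h1 h3) h2
  refine ⟨fun x => min 0 ((Real.log x - Real.log (selfFibCount x)) / W x - 1 / 2), ?_, ?_⟩
  · rw [Metric.tendsto_nhds]
    intro a ha
    have hδ : 0 < min (a / 10) (1 / 4) := by positivity
    filter_upwards [hWpos, eventually_log_selfFibCount_le hδ (min_le_right _ _)] with x hx hle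
    rw [Real.dist_eq, sub_zero, abs_of_nonpos (min_le_left _ _)]
    have h1 : 1 / 2 - 5 * min (a / 10) (1 / 4) ≤
        (Real.log x - Real.log (selfFibCount x)) / W x := by
      rw [le_div_iff₀ hx]; linarith
    have h2 : min (a / 10) (1 / 4) ≤ a / 10 := min_le_left _ _
    rw [neg_lt, lt_min_iff]
    constructor <;> linarith
  · filter_upwards [hWpos, eventually_ge_atTop 1] with x hx hx1
    have hx0 : 0 < x := by linarith
    have hlog : Real.log (selfFibCount x : ℝ) ≤ Real.log x -
        (1 / 2 + min 0 ((Real.log x - Real.log (selfFibCount x)) / W x - 1 / 2)) * W x := by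
      have h1 : (1 / 2 + min 0 ((Real.log x - Real.log (selfFibCount x)) / W x - 1 / 2)) ≤
          (Real.log x - Real.log (selfFibCount x)) / W x := by
        linarith [min_le_right 0 ((Real.log x - Real.log (selfFibCount x)) / W x - 1 / 2)]
      rw [le_div_iff₀ hx] at h1
      linarith
    refine ⟨hlog, ?_⟩
    have hpos : (0 : ℝ) < selfFibCount x := by
      exact_mod_cast one_le_selfFibCount hx1
    rw [Real.rpow_def_of_pos hx0, ← Real.log_le_iff_le_exp hpos]
    refine hlog.trans (le_of_eq ?_)
    simp only [hW]
    ring
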